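/- Setting. Let $\mathbb K$ be a field and $A=\mathbb K[x_1,\dots,x_n]$ with a positive $\mathbb Z^m$-grading: each $\deg x_j\in\mathbb Z^m$ is non zero with positive first non zero component, and the rows of the matrix with columns $\deg x_1,\dots,\deg x_n$ are linearly independent. Let $T\cong(\mathbb K^\times)^k$ be a torus acting $\mathbb K$-linearly on $A$, compatibly with grading and multiplication, such that every variable is a weight vector. A vector $v\neq 0$ has weight $w\in\mathbb Z^k$ if $\tau\cdot v=\tau_1^{w_1}\cdots\tau_k^{w_k}\,v$ for all $\tau\in T$. Consider the category of finitely generated $\mathbb Z^m$-graded $A$-modules with a $\mathbb K$-linear $T$-action that preserves graded components and satisfies $\tau\cdot(ax)=(\tau\cdot a)(\tau\cdot x)$ for homogeneous $a \in A$, $x$ in the module; its morphisms are the degree-preserving $A$-linear $T$-equivariant maps, and its free objects are those isomorphic to $V\otimes_{\mathbb K}A$ for a finite dimensional graded representation $V$ of $T$. Let $F_1\xrightarrow{d_1}F_0\xrightarrow{\pi}M\to0$ be an exact sequence in this category with $F_0,F_1$ free, and let $\mathcal F_0=\{f_1,\dots,f_s\}$ and $\mathcal F_1$ be homogeneous $A$-bases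 of $F_0$ and $F_1$. Let $N_1$ be the matrix of $d_1$ in these bases. Fix a term ordering on the monomials of $A$ and equip the terms $tf_i$ ($t$ a monomial) of $F_0$ with one of the module term orderings "term over position up", "position up over term" (both called position up; a larger index is larger), "term over position down", "position down over term" (both called position down; a smaller index is larger). Let $\tilde{\mathcal F}_0=\{\tilde f_1,\dots,\tilde f_s\}$ be a homogeneous basis of $F_0$ consisting of weight vectors, $W=(w_1,\dots,w_s)$ with $w_i$ a weight of $\tilde f_i$, and let $U=(u_{ij})$ be the matrix with $f_j=\sum_i u_{ij}\tilde f_i$. Assume that $U$ is upper triangular if the ordering is position up, and lower triangular if it is position down; if the ordering is a term over position ordering, assume moreover that the entries $u_{ij}$ lie in $\mathbb K$. Let $d\in\mathbb Z^m$. Algorithm, with input $(d,N_1,W)$. Compute a (finite) homogeneous Gröbner basis $\mathcal G$ of $\operatorname{im}d_1$; list, without repetition, all terms $tf_i$ of degree $d$ that are not divisible by the leading term of any element of $\mathcal G$; form the matrix $N$ whose columns are the component vectors of these terms in the basis $\mathcal F_0$; return the list $V$ obtained by applying the following procedure to $(N,W)$. Procedure. Permute the columns of $N$ so that $N$ becomes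 $(M_1\mid\dots\mid M_l)$, where the columns of the non-empty block $M_i$ all have the same degree $d_i$ and $d_1,\dots,d_l$ are distinct. For each block $M_i$, compute the reduced Gröbner basis of the module generated by its columns, truncate it at degree $d_i$ (keep the elements of degree at most $d_i$, with $\mathbb Z^m$ ordered lexicographically), and form the matrix $G$ whose columns are the remaining elements, sorted by increasing (position up) or decreasing (position down) leading terms, together with an invertible change of basis matrix $C_i$ such that $G=M_iC_i$. For each column of $G$, if its leading term is $tf_j$, record the weight $\operatorname{weight}(t)+w_j$. Concatenate the recorded lists, block after block. Proposition. The algorithm can be carried out (all the objects it asks for exist, so that it returns a list), and for every list $V=(v_1,\dots,v_r)$ that it returns, whatever choices are made, the graded component $M_d$ has a $\mathbb K$-basis $b_1,\dots,b_r$ such that each $b_i$ is a weight vector of weight $v_i$. -/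

import Mathlib

open scoped TensorProduct

namespace WeightPropagation

universe u

/-- The polynomial ring `A = K[x_1, …, x_n]`. -/
abbrev PolyRing (K : Type u) [Field K] (n : ℕ) := MvPolynomial (Fin n) K

/-- A positive `ℤ^m`-grading of `K[x_1, …, x_n]`, given by the degrees `δ j` of the variables: every
degree is a non zero vector whose first non zero component is positive, and the rows of the
matrix with columns `δ j` are linearly independent. -/
structure IsPositiveGrading {n m : ℕ} (δ : Fin n → Fin m → ℤ) : Prop where
  first_pos : ∀ j, ∃ i, 0 < δ j i ∧ ∀ i' < i, δ j i' = 0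
  rows_indep : LinearIndependent ℤ (fun (i : Fin m) (j : Fin n) => δ j i)

section Objects

variable {K : Type u} [Field K] {n m k : ℕ} {T : Type*} [Group T]

/-- The character of the torus `T ≅ (Kˣ)^k` (with coordinates `θ`) that corresponds to `w ∈ ℤ^k`. -/
def character (θ : T ≃* (Fin k → Kˣ)) (w : Fin k → ℤ) (τ : T) : Kˣ :=
  ∏ i, (θ τ i) ^ (w i)

/-- `v` is a weight vector of the representation `ρ` with weight `w ∈ ℤ^k`. -/
def HasWeight (θ : T ≃* (Fin k → Kˣ)) {V : Type*} [AddCommGroup V] [Module K V]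
    (ρ : Representation K T V) (v : V) (w : Fin k → ℤ) : Prop :=
  v ≠ 0 ∧ ∀ τ, ρ τ v = (character θ w τ : K) • v

variable (K T) in
/-- A `K`-linear action of `T` on the polynomial ring, graded by the degrees `δ` of the
variables, which is compatible with grading and multiplication. -/
structure PolyAction (δ : Fin n → Fin m → ℤ) where
  ρ : Representation K T (PolyRing K n)
  map_mem : ∀ τ d a, a ∈ MvPolynomial.weightedHomogeneousSubmodule K δ d →
    ρ τ a ∈ MvPolynomial.weightedHomogeneousSubmodule K δ d
  map_mul : ∀ τ d d' a b, a ∈ MvPolynomial.weightedHomogeneousSubmodule K δ d →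
    b ∈ MvPolynomial.weightedHomogeneousSubmodule K δ d' → ρ τ (a * b) = ρ τ a * ρ τ b

variable (K T m) in
/-- A `ℤ^m`-graded representation of `T`. -/
structure GradedRep (V : Type*) [AddCommGroup V] [Module K V] where
  comp : (Fin m → ℤ) → Submodule K V
  isInternal : DirectSum.IsInternal comp
  ρ : Representation K T V
  map_mem : ∀ τ d v, v ∈ comp d → ρ τ v ∈ comp d

/-- The structure of an object of the category of finitely generated graded modules over the
polynomial ring with a `K`-linear action of `T` compatible with grading and multiplication,
on an `A`-module `M`. -/
structure EquivModule {δ : Fin n → Fin m → ℤ} (act : PolyAction K T δ)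
    (M : Type*) [AddCommGroup M] [Module K M] [Module (PolyRing K n) M] [IsScalarTower K (PolyRing K n) M]
    extends GradedRep K m T M where
  finite : Module.Finite (PolyRing K n) M
  smul_mem : ∀ d d' a x, a ∈ MvPolynomial.weightedHomogeneousSubmodule K δ d →
    x ∈ comp d' → a • x ∈ comp (d + d')
  map_smul : ∀ τ d d' a x, a ∈ MvPolynomial.weightedHomogeneousSubmodule K δ d →
    x ∈ comp d' → ρ τ (a • x) = act.ρ τ a • ρ τ x

variable {δ : Fin n → Fin m → ℤ} {act : PolyAction K T δ}
  {M : Type*} [AddCommGroup M] [Module K M] [Module (PolyRing K n) M] [IsScalarTower K (PolyRing K n) M]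
  {N : Type*} [AddCommGroup N] [Module K N] [Module (PolyRing K n) N] [IsScalarTower K (PolyRing K n) N]

/-- Morphisms: homogeneous (degree preserving) `A`-linear `T`-equivariant maps. -/
structure IsMorphism (X : EquivModule act M) (Y : EquivModule act N)
    (φ : M →ₗ[PolyRing K n] N) : Prop where
  map_mem : ∀ d x, x ∈ X.comp d → φ x ∈ Y.comp d
  equivariant : ∀ τ x, φ (X.ρ τ x) = Y.ρ τ (φ x)

/-- Free objects: those isomorphic to `A ⊗ V` for a finite dimensional graded representation
`V` of `T`, with the usual `A`-module structure, total grading and diagonal action. -/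
def IsFreeObject (X : EquivModule act M) : Prop :=
  ∃ (V : Type u) (_ : AddCommGroup V) (_ : Module K V) (_ : FiniteDimensional K V)
    (R : GradedRep K m T V) (φ : (PolyRing K n ⊗[K] V) ≃ₗ[PolyRing K n] M),
    (∀ d d' a v, a ∈ MvPolynomial.weightedHomogeneousSubmodule K δ d → v ∈ R.comp d' →
      φ (a ⊗ₜ[K] v) ∈ X.comp (d + d')) ∧
    ∀ τ x, φ (TensorProduct.map (act.ρ τ) (R.ρ τ) x) = X.ρ τ (φ x)

end Objects

section Terms

variable {K : Type u} [Field K] {n m s : ℕ}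

/-- The term `t f_i` of a free module with ordered basis `f_1, …, f_s` is the pair of the exponent
of `t` and the index `i`. -/
abbrev Term (n s : ℕ) := (Fin n →₀ ℕ) × Fin s

/-- Divisibility of terms. -/
def Term.Divides (p q : Term n s) : Prop := p.1 ≤ q.1 ∧ p.2 = q.2

/-- The degree of `t f_i` when the variables have degrees `δ` and `f_i` has degree `e i`. -/
noncomputable def Term.degree (δ : Fin n → Fin m → ℤ) (e : Fin s → Fin m → ℤ) (p : Term n s) : Fin m → ℤ :=
  Finsupp.weight δ p.1 + e p.2

/-- The four module term orderings that extend a term ordering. -/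
inductive ModuleOrderKind where
  | termOverPositionUp
  | positionUpOverTerm
  | termOverPositionDown
  | positionDownOverTerm

/-- The position up module term orderings. -/
def ModuleOrderKind.IsUp : ModuleOrderKind → Prop
  | termOverPositionUp => True
  | positionUpOverTerm => True
  | termOverPositionDown => False
  | positionDownOverTerm => False

/-- The term over position module term orderings. -/
def ModuleOrderKind.IsTermOverPosition : ModuleOrderKind → Prop
  | termOverPositionUp => True
  | positionUpOverTerm => False
  | termOverPositionDown => True
  | positionDownOverTerm => False

/-- `Term.Lt σ κ p q` is the strict inequality `p < q` in the module term ordering of kind `κ`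
that extends the term ordering `σ`. -/
def Term.Lt (σ : MonomialOrder (Fin n)) : ModuleOrderKind → Term n s → Term n s → Prop
  | .termOverPositionUp, p, q => σ.toSyn p.1 < σ.toSyn q.1 ∨ (p.1 = q.1 ∧ p.2 < q.2)
  | .positionUpOverTerm, p, q => p.2 < q.2 ∨ (p.2 = q.2 ∧ σ.toSyn p.1 < σ.toSyn q.1)
  | .termOverPositionDown, p, q => σ.toSyn p.1 < σ.toSyn q.1 ∨ (p.1 = q.1 ∧ q.2 < p.2)
  | .positionDownOverTerm, p, q => q.2 < p.2 ∨ (p.2 = q.2 ∧ σ.toSyn p.1 < σ.toSyn q.1)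

/-- The support of a component vector: the terms that occur in it. -/
def termSupport (v : Fin s → PolyRing K n) : Set (Term n s) := {p | (v p.2).coeff p.1 ≠ 0}

/-- The component vector of a term. -/
noncomputable def Term.vec (K : Type u) [Field K] (p : Term n s) : Fin s → PolyRing K n :=
  Pi.single p.2 (MvPolynomial.monomial p.1 1)

/-- `p` is the leading term of `v`. -/
def IsLT (σ : MonomialOrder (Fin n)) (κ : ModuleOrderKind) (v : Fin s → PolyRing K n)
    (p : Term n s) : Prop :=
  p ∈ termSupport v ∧ ∀ q ∈ termSupport v, q ≠ p → Term.Lt σ κ q p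

/-- `v` is homogeneous of degree `d` (the zero vector is so for every `d`). -/
def IsHomog (δ : Fin n → Fin m → ℤ) (e : Fin s → Fin m → ℤ) (v : Fin s → PolyRing K n)
    (d : Fin m → ℤ) : Prop :=
  ∀ p ∈ termSupport v, Term.degree δ e p = d

/-- `G` is a Gröbner basis of the submodule `S`. -/
structure IsGroebnerBasis (σ : MonomialOrder (Fin n)) (κ : ModuleOrderKind)
    (S : Submodule (PolyRing K n) (Fin s → PolyRing K n)) (G : Set (Fin s → PolyRing K n)) : Prop where
  finite : G.Finite
  subset : ∀ g ∈ G, g ∈ S ∧ g ≠ 0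
  divides : ∀ v ∈ S, ∀ p, IsLT σ κ v p → ∃ g ∈ G, ∃ q, IsLT σ κ g q ∧ q.Divides p

/-- `G` is the reduced Gröbner basis of the submodule `S`. -/
structure IsReducedGroebnerBasis (σ : MonomialOrder (Fin n)) (κ : ModuleOrderKind)
    (S : Submodule (PolyRing K n) (Fin s → PolyRing K n)) (G : Set (Fin s → PolyRing K n)) : Prop
    extends IsGroebnerBasis σ κ S G where
  monic : ∀ g ∈ G, ∀ p, IsLT σ κ g p → (g p.2).coeff p.1 = 1
  reduced : ∀ g ∈ G, ∀ p ∈ termSupport g, ∀ g' ∈ G, g' ≠ g → ∀ q, IsLT σ κ g' q → ¬ q.Divides p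

/-- The truncation at degree `d`: the homogeneous elements of `G` of degree at most `d`, where
`ℤ^m` is ordered lexicographically. -/
def truncation (δ : Fin n → Fin m → ℤ) (e : Fin s → Fin m → ℤ) (G : Set (Fin s → PolyRing K n))
    (d : Fin m → ℤ) : Set (Fin s → PolyRing K n) :=
  {g ∈ G | ∃ d', IsHomog δ e g d' ∧ toLex d' ≤ toLex d}

/-- The submodule generated by the columns of a matrix, i.e. the image of the map. -/
noncomputable def columnSpan {r : ℕ} (N : Matrix (Fin s) (Fin r) (PolyRing K n)) :
    Submodule (PolyRing K n) (Fin s → PolyRing K n) :=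
  Submodule.span (PolyRing K n) (Set.range N.col)

end Terms

/-! The algorithms, as relations between the input and the possible outputs. A step that leaves a
choice (such as the choice of a Gröbner basis) is an existential quantifier. The
parameters `θ`, `act`, `e`, `σ`, `κ` are the ambient data: the torus and its action on the polynomial
ring, the degrees of the basis elements of the codomain, the module term ordering. -/

section Algorithms

variable {K : Type u} [Field K] {n m k s : ℕ} {T : Type*} [Group T]
  (θ : T ≃* (Fin k → Kˣ)) {δ : Fin n → Fin m → ℤ} (act : PolyAction K T δ)
  (e : Fin s → Fin m → ℤ) (σ : MonomialOrder (Fin n)) (κ : ModuleOrderKind)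

/-- Weight propagation along a map with domain in a single degree: on input `(N, W)`, the pair
`(C, V)` is returned. The change of basis `C` is between homogeneous bases of a module generated in
a single degree, so its entries are constants. -/
def PropagateSingleDegree {r : ℕ} (N : Matrix (Fin s) (Fin r) (PolyRing K n))
    (W : Fin s → Fin k → ℤ) (C : Matrix (Fin r) (Fin r) K) (V : Fin r → Fin k → ℤ) : Prop :=
  ∃ (hr : 0 < r) (d : Fin m → ℤ) (𝒢 : Set (Fin s → PolyRing K n))
    (G : Matrix (Fin s) (Fin r) (PolyRing K n)),
    -- `d` is the degree of the first column
    (N.col ⟨0, hr⟩ ≠ 0 ∧ IsHomog δ e (N.col ⟨0, hr⟩) d) ∧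
    IsReducedGroebnerBasis σ κ (columnSpan N) 𝒢 ∧
    -- the columns of `G` are the elements of the truncation, sorted by their leading terms
    Set.range G.col = truncation δ e 𝒢 d ∧
    (∀ i j, i < j → ∀ p q, IsLT σ κ (G.col i) p → IsLT σ κ (G.col j) q →
      (κ.IsUp → Term.Lt σ κ p q) ∧ (¬ κ.IsUp → Term.Lt σ κ q p)) ∧
    IsUnit C ∧ G = N * C.map MvPolynomial.C ∧
    -- `v_i = weight(t) + w_j`, where `t f_j` is the leading term of the `i`-th column of `G`
    ∀ i, ∃ p : Term n s, IsLT σ κ (G.col i) p ∧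
      ∃ w : Fin k → ℤ, HasWeight θ act.ρ (MvPolynomial.monomial p.1 1) w ∧ V i = w + W p.2

/-- Weight propagation along a map: on input `(N, W)`, the pair `(C, V)` is returned. The columns of
`N` are permuted by `P`, so that those of the same degree become contiguous, and form `l` blocks of
`c 0, …, c (l - 1)` columns; `ι` gives the position of a column of a block
among all columns of the permuted matrix. -/
def Propagate {r : ℕ} (N : Matrix (Fin s) (Fin r) (PolyRing K n))
    (W : Fin s → Fin k → ℤ) (C : Matrix (Fin r) (Fin r) K) (V : List (Fin k → ℤ)) : Prop :=
  ∃ (P : Equiv.Perm (Fin r)) (l : ℕ) (c : Fin l → ℕ) (hc : ∑ i, c i = r)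
    (D : Fin l → Fin m → ℤ) (Cs : (i : Fin l) → Matrix (Fin (c i)) (Fin (c i)) K)
    (Vs : (i : Fin l) → Fin (c i) → Fin k → ℤ),
    let ι : (Σ i : Fin l, Fin (c i)) ≃ Fin r := finSigmaFinEquiv.trans (finCongr hc)
    let block (i : Fin l) : Matrix (Fin s) (Fin (c i)) (PolyRing K n) :=
      Matrix.of fun a b => N a (P (ι ⟨i, b⟩))
    (∀ i, 0 < c i) ∧
    (∀ i b, (block i).col b ≠ 0 ∧ IsHomog δ e ((block i).col b) (D i)) ∧
    Function.Injective D ∧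
    (∀ i, PropagateSingleDegree θ act e σ κ (block i) W (Cs i) (Vs i)) ∧
    C = Matrix.reindex (ι.trans P) ι (Matrix.blockDiagonal' Cs) ∧
    V = (List.ofFn fun i => List.ofFn (Vs i)).flatten

/-- Weight propagation for graded components: on input `(d, N₁, W)`, the list `V` is returned. -/
def PropagateGradedComponents {q : ℕ} (d : Fin m → ℤ) (N₁ : Matrix (Fin s) (Fin q) (PolyRing K n))
    (W : Fin s → Fin k → ℤ) (V : List (Fin k → ℤ)) : Prop :=
  ∃ (𝒢 : Set (Fin s → PolyRing K n)) (L : List (Term n s)),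
    (IsGroebnerBasis σ κ (columnSpan N₁) 𝒢 ∧ ∀ g ∈ 𝒢, ∃ d', IsHomog δ e g d') ∧
    -- `L` lists the terms of degree `d` not divisible by any leading term of `𝒢`
    (L.Nodup ∧ ∀ p : Term n s, p ∈ L ↔
      Term.degree δ e p = d ∧ ∀ g ∈ 𝒢, ∀ q, IsLT σ κ g q → ¬ q.Divides p) ∧
    ∃ C : Matrix (Fin L.length) (Fin L.length) K,
      Propagate θ act e σ κ (Matrix.of fun i j => (L.get j).vec K i) W C V

end Algorithms

end WeightPropagation

open WeightPropagation

/-! The matrix `N` has distinct terms of one degree `d` as columns. The grading is positive, so none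
of these terms properly divides another, and they already form the reduced Gröbner basis of the
module they generate. The procedure therefore only sorts them, and the output lists weight(t) + w_j
over the terms t f_j of degree `d` outside the leading term module of im d₁.
`Propagate.exists_terms` extracts this from an arbitrary run: in each block the recorded leading
terms are distinct and lie among the columns, so by counting they are all of them.

These numbers are weights of a basis of M_d because of triangularity. The coordinates of f̃_j form
the j-th column of U⁻¹, which is triangular in the direction of the ordering with nonzero constants
on the diagonal, so f̃_j has leading term f_j (`isLT_col_of_triangular`). Hence t f̃_j is
homogeneous with leading term t f_j. Macaulay's argument (`exists_basis_of_standard_terms`) needs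
only these leading terms to show that the images of the t f̃_j form a basis of M_d, and equivariance
gives each image the weight weight(t) + w_j.

A run exists because im d₁ = ker π contains the homogeneous components of its elements, so that
Dickson's lemma gives a homogeneous Gröbner basis, and because each degree contains finitely many
terms. -/

namespace WeightPropagation

/-! ### Module term orderings and Dickson's lemma -/

section TermOrder

universe w

variable {n s : ℕ}

/-- A module term ordering is the pullback of a well order along an injective map. -/
theorem Term.exists_key (σ : MonomialOrder.{0, w} (Fin n)) (κ : ModuleOrderKind) (s : ℕ) :
    ∃ (α : Type w) (_ : LinearOrder α) (_ : WellFoundedLT α) (key : Term n s → α),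
      Function.Injective key ∧ ∀ p q, Term.Lt σ κ p q ↔ key p < key q := by
  cases κ
  · refine ⟨σ.syn ×ₗ Fin s, inferInstance, inferInstance, fun p => toLex (σ.toSyn p.1, p.2),
      ?_, ?_⟩
    · intro p q h
      simpa [Prod.ext_iff] using h
    · intro p q
      simp [Term.Lt, Prod.Lex.toLex_lt_toLex]
  · refine ⟨Fin s ×ₗ σ.syn, inferInstance, inferInstance, fun p => toLex (p.2, σ.toSyn p.1),
      ?_, ?_⟩
    · intro p q h
      simpa [Prod.ext_iff, and_comm] using h
    · intro p q
      simp [Term.Lt, Prod.Lex.toLex_lt_toLex]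
  -- Reversing the positions keeps the order well founded, since `Fin s` is finite.
  · refine ⟨σ.syn ×ₗ (Fin s)ᵒᵈ, inferInstance, inferInstance,
      fun p => toLex (σ.toSyn p.1, OrderDual.toDual p.2), ?_, ?_⟩
    · intro p q h
      simpa [Prod.ext_iff] using h
    · intro p q
      simp [Term.Lt, Prod.Lex.toLex_lt_toLex]
  · refine ⟨(Fin s)ᵒᵈ ×ₗ σ.syn, inferInstance, inferInstance,
      fun p => toLex (OrderDual.toDual p.2, σ.toSyn p.1), ?_, ?_⟩
    · intro p q h
      simpa [Prod.ext_iff, and_comm] using h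
    · intro p q
      simp [Term.Lt, Prod.Lex.toLex_lt_toLex]

variable {σ : MonomialOrder (Fin n)} {κ : ModuleOrderKind}

theorem Term.lt_irrefl (p : Term n s) : ¬ Term.Lt σ κ p p := by
  obtain ⟨α, _, _, key, -, h⟩ := Term.exists_key σ κ s
  simp [h]

theorem Term.Lt.trans {p q r : Term n s} (h₁ : Term.Lt σ κ p q) (h₂ : Term.Lt σ κ q r) :
    Term.Lt σ κ p r := by
  obtain ⟨α, _, _, key, -, h⟩ := Term.exists_key σ κ s
  rw [h] at *
  exact h₁.trans h₂

theorem Term.lt_wellFounded (σ : MonomialOrder (Fin n)) (κ : ModuleOrderKind) (s : ℕ) :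
    WellFounded (Term.Lt σ κ : Term n s → Term n s → Prop) := by
  obtain ⟨α, _, _, key, -, h⟩ := Term.exists_key σ κ s
  have : (Term.Lt σ κ : Term n s → Term n s → Prop) = InvImage (· < ·) key := by
    funext p q
    exact propext (h p q)
  rw [this]
  exact InvImage.wf key wellFounded_lt

theorem Term.Lt.add_left (a : Fin n →₀ ℕ) {p q : Term n s} (h : Term.Lt σ κ p q) :
    Term.Lt σ κ (a + p.1, p.2) (a + q.1, q.2) := by
  cases κ <;> simpa [Term.Lt] using h

/-- A non empty finite set of terms has a greatest element. -/
theorem Term.exists_greatest (σ : MonomialOrder (Fin n)) (κ : ModuleOrderKind)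
    {P : Set (Term n s)} (hP : P.Finite) (hne : P.Nonempty) :
    ∃ p ∈ P, ∀ q ∈ P, q ≠ p → Term.Lt σ κ q p := by
  obtain ⟨α, _, _, key, hinj, h⟩ := Term.exists_key σ κ s
  obtain ⟨p, hp, hmax⟩ := P.exists_max_image key hP hne
  exact ⟨p, hp, fun q hq hqp => (h q p).2 ((hmax q hq).lt_of_ne fun h' => hqp (hinj h'))⟩

theorem Term.Divides.isPWO (P : Set (Term n s)) : P.PartiallyWellOrderedOn Term.Divides := by
  have h₁ : (Set.univ : Set (Fin n →₀ ℕ)).IsPWO := Set.isPWO_of_wellQuasiOrderedLE _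
  have h₂ : (Set.univ : Set (Fin s)).PartiallyWellOrderedOn (· = ·) :=
    Set.Finite.partiallyWellOrderedOn Set.finite_univ
  refine Set.partiallyWellOrderedOn_iff_exists_lt.2 fun f hf => ?_
  obtain ⟨g, hg⟩ := h₁.exists_monotone_subseq (f := fun i => (f i).1) (fun _ => trivial)
  obtain ⟨a, b, hab, h⟩ := h₂.exists_lt (f := fun i => (f (g i)).2) (fun _ => trivial)
  exact ⟨g a, g b, g.strictMono hab, hg hab.le, h⟩

theorem Term.Divides.refl (p : Term n s) : p.Divides p := ⟨le_rfl, rfl⟩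

theorem Term.Divides.trans {p q r : Term n s} (h₁ : p.Divides q) (h₂ : q.Divides r) :
    p.Divides r := ⟨h₁.1.trans h₂.1, h₁.2.trans h₂.2⟩

/-- Dickson's lemma: every set of terms has finitely many elements that divide all others. -/
theorem Term.exists_finite_divides (P : Set (Term n s)) :
    ∃ Q ⊆ P, Q.Finite ∧ ∀ p ∈ P, ∃ q ∈ Q, q.Divides p := by
  -- The minimal elements form an antichain, which is finite. Descent on the total degree of the
  -- exponent finds one below each term.
  let Q : Set (Term n s) := {q ∈ P | ∀ p ∈ P, p.Divides q → p = q}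
  refine ⟨Q, fun q hq => hq.1, ?_, ?_⟩
  · have hanti : IsAntichain Term.Divides Q := fun a ha b hb hab h => hab (hb.2 a ha.1 h)
    exact hanti.finite_of_partiallyWellOrderedOn (Term.Divides.isPWO Q)
  · intro p
    induction hp : Finsupp.degree p.1 using Nat.strong_induction_on generalizing p with
    | _ N ih =>
    intro hpP
    by_cases hpQ : p ∈ Q
    · exact ⟨p, hpQ, Term.Divides.refl p⟩
    · obtain ⟨r, hr, hrp, hne⟩ : ∃ r ∈ P, r.Divides p ∧ r ≠ p := by
        by_contra hcon
        push Not at hcon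
        exact hpQ ⟨hpP, hcon⟩
      have hlt : Finsupp.degree r.1 < N := by
        subst hp
        obtain ⟨c, hc⟩ := exists_add_of_le hrp.1
        rw [hc, map_add]
        have : c ≠ 0 := by
          rintro rfl
          exact hne (Prod.ext (by simpa using hc.symm) hrp.2)
        have : Finsupp.degree c ≠ 0 := by rwa [Ne, Finsupp.degree_eq_zero_iff]
        omega
      obtain ⟨q, hq, hqr⟩ := ih _ hlt r rfl hr
      exact ⟨q, hq, hqr.trans hrp⟩

end TermOrder

/-! ### Consequences of positivity of the grading -/

section Degree

variable {n m s : ℕ} {δ : Fin n → Fin m → ℤ} {e : Fin s → Fin m → ℤ}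

/-- Each variable has lexicographically positive degree, so a nonempty product of variables does
too. -/
theorem IsPositiveGrading.eq_zero_of_weight (hδ : IsPositiveGrading δ) {a : Fin n →₀ ℕ}
    (ha : Finsupp.weight δ a = 0) : a = 0 := by
  have hpos : ∀ j, 0 < toLex (δ j) := by
    intro j
    obtain ⟨i, hi, hlt⟩ := hδ.first_pos j
    exact ⟨i, fun i' h => (hlt i' h).symm, hi⟩
  by_contra hne
  obtain ⟨j, hj⟩ := Finsupp.ne_iff.1 hne
  have : 0 < ∑ i, a i • toLex (δ i) :=
    Finset.sum_pos' (fun i _ => nsmul_nonneg (hpos i).le _)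
      ⟨j, Finset.mem_univ _, nsmul_pos (hpos j) hj⟩
  refine this.ne' ?_
  rw [Finsupp.weight_apply, Finsupp.sum_fintype _ _ (by simp)] at ha
  exact ha

/-- The quotient is a monomial of degree 0, hence trivial. Terms of one degree are thus an antichain
for divisibility, which makes them finite in number and makes a set of them a reduced Gröbner basis.
-/
theorem Term.Divides.eq_of_degree_eq (hδ : IsPositiveGrading δ) {p q : Term n s}
    (h : p.Divides q) (hdeg : p.degree δ e = q.degree δ e) : p = q := by
  obtain ⟨c, hc⟩ := exists_add_of_le h.1
  have : c = 0 := by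
    apply hδ.eq_zero_of_weight
    simpa [Term.degree, hc, h.2] using hdeg
  exact Prod.ext (by simp [hc, this]) h.2

/-- There are finitely many terms of a given degree. -/
theorem Term.finite_degree_eq (hδ : IsPositiveGrading δ) (e : Fin s → Fin m → ℤ)
    (d : Fin m → ℤ) : {p : Term n s | p.degree δ e = d}.Finite := by
  refine IsAntichain.finite_of_partiallyWellOrderedOn (r := Term.Divides) ?_
    (Term.Divides.isPWO _)
  intro p hp q hq hne h
  exact hne (h.eq_of_degree_eq hδ (hp.trans hq.symm))

end Degree

/-! ### Leading terms and reduction -/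

section LeadingTerm

variable {K : Type*} [Field K] {n m s : ℕ} {δ : Fin n → Fin m → ℤ} {e : Fin s → Fin m → ℤ}
  {σ : MonomialOrder (Fin n)} {κ : ModuleOrderKind}

theorem mem_termSupport {v : Fin s → PolyRing K n} {p : Term n s} :
    p ∈ termSupport v ↔ (v p.2).coeff p.1 ≠ 0 := Iff.rfl

theorem termSupport_finite (v : Fin s → PolyRing K n) : (termSupport v).Finite := by
  classical
  refine (Finset.univ.biUnion fun i => (v i).support.image (·, i)).finite_toSet.subset ?_
  intro p hp
  simp only [Finset.coe_biUnion, Set.mem_iUnion, Finset.mem_coe, Finset.mem_image]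
  exact ⟨p.2, Finset.mem_univ _, p.1, MvPolynomial.mem_support_iff.2 hp, rfl⟩

theorem termSupport_nonempty {v : Fin s → PolyRing K n} (hv : v ≠ 0) :
    (termSupport v).Nonempty := by
  obtain ⟨i, hi⟩ := Function.ne_iff.1 hv
  obtain ⟨a, ha⟩ := MvPolynomial.ne_zero_iff.1 hi
  exact ⟨(a, i), ha⟩

theorem exists_isLT (σ : MonomialOrder (Fin n)) (κ : ModuleOrderKind)
    {v : Fin s → PolyRing K n} (hv : v ≠ 0) : ∃ p, IsLT σ κ v p :=
  Term.exists_greatest σ κ (termSupport_finite v) (termSupport_nonempty hv)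

theorem IsLT.unique {v : Fin s → PolyRing K n} {p q : Term n s} (hp : IsLT σ κ v p)
    (hq : IsLT σ κ v q) : p = q := by
  by_contra hne
  exact Term.lt_irrefl p ((hq.2 p hp.1 hne).trans (hp.2 q hq.1 (Ne.symm hne)))

theorem IsLT.ne_zero {v : Fin s → PolyRing K n} {p : Term n s} (hp : IsLT σ κ v p) :
    v ≠ 0 := by
  rintro rfl
  exact hp.1 (by simp)

theorem Term.coeff_vec (p q : Term n s) [Decidable (p = q)] :
    (p.vec K q.2).coeff q.1 = if p = q then 1 else 0 := by
  classical
  by_cases h : q.2 = p.2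
  · rw [Term.vec, h, Pi.single_eq_same, MvPolynomial.coeff_monomial]
    simp [Prod.ext_iff, h]
  · rw [Term.vec, Pi.single_eq_of_ne h, MvPolynomial.coeff_zero, if_neg]
    rintro rfl
    exact h rfl

theorem Term.mem_termSupport_vec {p q : Term n s} : q ∈ termSupport (p.vec K) ↔ p = q := by
  classical
  simp [mem_termSupport, Term.coeff_vec]

theorem Term.isLT_vec (p : Term n s) : IsLT σ κ (p.vec K) p :=
  ⟨Term.mem_termSupport_vec.2 rfl, fun _ hq hne => (hne (Term.mem_termSupport_vec.1 hq).symm).elim⟩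

theorem Term.isHomog_vec (p : Term n s) : IsHomog δ e (p.vec K) (p.degree δ e) := by
  intro q hq
  rw [Term.mem_termSupport_vec.1 hq]

theorem Term.vec_ne_zero (p : Term n s) : p.vec K ≠ 0 := by
  have h : p ∈ termSupport (p.vec K) := Term.mem_termSupport_vec.2 rfl
  intro h0
  rw [h0] at h
  exact h (by simp)

/-- A subspace that contains the terms of a vector contains the vector. -/
theorem mem_of_forall_vec_mem (S : Submodule K (Fin s → PolyRing K n))
    {v : Fin s → PolyRing K n} (h : ∀ p ∈ termSupport v, p.vec K ∈ S) : v ∈ S := by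
  have hv : v = ∑ i, ∑ a ∈ (v i).support, (v i).coeff a • Term.vec K (a, i) := by
    funext j
    rw [Finset.sum_apply, Finset.sum_eq_single j]
    · conv_lhs => rw [(v j).as_sum]
      simp [Term.vec, MvPolynomial.smul_monomial]
    · intro i _ hij
      simp [Term.vec, Pi.single_eq_of_ne hij.symm]
    · simp
  rw [hv]
  exact Submodule.sum_mem _ fun i _ => Submodule.sum_mem _ fun a ha =>
    Submodule.smul_mem _ _ (h (a, i) (MvPolynomial.mem_support_iff.1 ha))

theorem mem_termSupport_monomial_smul {a : Fin n →₀ ℕ} {v : Fin s → PolyRing K n}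
    {p : Term n s} :
    p ∈ termSupport ((MvPolynomial.monomial a 1 : PolyRing K n) • v) ↔
      ∃ q ∈ termSupport v, p = (a + q.1, q.2) := by
  classical
  rw [mem_termSupport, Pi.smul_apply, smul_eq_mul, MvPolynomial.coeff_monomial_mul']
  constructor
  · intro h
    by_cases hle : a ≤ p.1
    · rw [if_pos hle, one_mul] at h
      exact ⟨(p.1 - a, p.2), h, Prod.ext (add_tsub_cancel_of_le hle).symm rfl⟩
    · exact (h (if_neg hle)).elim
  · rintro ⟨q, hq, rfl⟩
    simpa [mem_termSupport] using hq

theorem IsLT.monomial_smul (a : Fin n →₀ ℕ) {v : Fin s → PolyRing K n} {p : Term n s}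
    (h : IsLT σ κ v p) :
    IsLT σ κ ((MvPolynomial.monomial a 1 : PolyRing K n) • v) (a + p.1, p.2) := by
  refine ⟨mem_termSupport_monomial_smul.2 ⟨p, h.1, rfl⟩, ?_⟩
  intro r hr hne
  obtain ⟨q, hq, rfl⟩ := mem_termSupport_monomial_smul.1 hr
  refine (h.2 q hq ?_).add_left a
  rintro rfl
  exact hne rfl

theorem IsHomog.monomial_smul (a : Fin n →₀ ℕ) {v : Fin s → PolyRing K n} {d : Fin m → ℤ}
    (h : IsHomog δ e v d) :
    IsHomog δ e ((MvPolynomial.monomial a 1 : PolyRing K n) • v) (Finsupp.weight δ a + d) := by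
  intro r hr
  obtain ⟨q, hq, rfl⟩ := mem_termSupport_monomial_smul.1 hr
  rw [← h q hq]
  simp [Term.degree, add_assoc]

theorem IsHomog.sub {v w : Fin s → PolyRing K n} {d : Fin m → ℤ} (hv : IsHomog δ e v d)
    (hw : IsHomog δ e w d) : IsHomog δ e (v - w) d := by
  intro p hp
  by_cases h : p ∈ termSupport v
  · exact hv p h
  · refine hw p fun h' => hp ?_
    have h : (v p.2).coeff p.1 = 0 := not_not.1 h
    simp [h, h']

theorem IsHomog.smul (c : K) {v : Fin s → PolyRing K n} {d : Fin m → ℤ}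
    (hv : IsHomog δ e v d) : IsHomog δ e (c • v) d := by
  intro p hp
  refine hv p fun h => hp ?_
  simp [h]

/-- If every term of degree `d` is a leading term of a homogeneous element of a subspace, then the
subspace contains all homogeneous vectors of degree `d`. -/
theorem mem_of_forall_exists_isLT (σ : MonomialOrder (Fin n)) (κ : ModuleOrderKind)
    (S : Submodule K (Fin s → PolyRing K n)) {d : Fin m → ℤ}
    (h : ∀ p : Term n s, p.degree δ e = d → ∃ w ∈ S, IsHomog δ e w d ∧ IsLT σ κ w p)
    {v : Fin s → PolyRing K n} (hv : IsHomog δ e v d) : v ∈ S := by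
  by_cases hv0 : v = 0
  · exact hv0 ▸ S.zero_mem
  obtain ⟨p, hp⟩ := exists_isLT σ κ hv0
  induction p using (Term.lt_wellFounded σ κ s).induction generalizing v with
  | _ p ih =>
  obtain ⟨w, hwS, hw, hwp⟩ := h p (hv p hp.1)
  -- This scalar cancels the coefficient at `p`; all terms left in `v - c • w` are below `p`, so the
  -- induction hypothesis applies.
  set c : K := (v p.2).coeff p.1 / (w p.2).coeff p.1 with hc
  have hmem : v - c • w ∈ S := by
    by_cases h0 : v - c • w = 0
    · exact h0 ▸ S.zero_mem
    obtain ⟨q, hq⟩ := exists_isLT σ κ h0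
    refine ih q ?_ (hv.sub (hw.smul c)) h0 hq
    have hqp : q ≠ p := by
      rintro rfl
      refine hq.1 ?_
      have := hwp.1
      rw [mem_termSupport] at this
      simp [hc, div_mul_cancel₀ _ this]
    by_cases hqv : q ∈ termSupport v
    · exact hp.2 q hqv hqp
    · refine hwp.2 q (fun h' => hq.1 ?_) hqp
      have hqv : (v q.2).coeff q.1 = 0 := not_not.1 hqv
      simp [hqv, h']
  have := S.add_mem hmem (S.smul_mem c hwS)
  rwa [sub_add_cancel] at this

/-- A non trivial linear combination of vectors with distinct leading terms has one of them as its
leading term. -/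
theorem exists_isLT_sum {ι : Type*} [Fintype ι] {B : ι → Fin s → PolyRing K n}
    {p : ι → Term n s} (hp : Function.Injective p) (hB : ∀ i, IsLT σ κ (B i) (p i))
    {c : ι → K} (hc : c ≠ 0) : ∃ i, IsLT σ κ (∑ i, c i • B i) (p i) := by
  classical
  obtain ⟨i₀, hi₀⟩ := Function.ne_iff.1 hc
  -- The greatest leading term among the summands with nonzero coefficient cannot cancel: all terms
  -- of the other summands are smaller.
  obtain ⟨_, ⟨i, hi, rfl⟩, hmax⟩ := Term.exists_greatest σ κ
    (P := p '' {i | c i ≠ 0}) (Set.toFinite _) ⟨_, i₀, hi₀, rfl⟩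
  have hlt : ∀ j, c j ≠ 0 → j ≠ i → Term.Lt σ κ (p j) (p i) := fun j hj hji =>
    hmax _ ⟨j, hj, rfl⟩ fun h => hji (hp h)
  have hcoeff : ∀ q : Term n s, ((∑ i, c i • B i) q.2).coeff q.1 =
      ∑ i, c i * (B i q.2).coeff q.1 := by
    intro q
    simp [Finset.sum_apply, MvPolynomial.coeff_sum]
  refine ⟨i, ?_, ?_⟩
  · rw [mem_termSupport, hcoeff, Finset.sum_eq_single i]
    · exact mul_ne_zero hi (hB i).1
    · intro j _ hji
      by_contra hne
      have hj := left_ne_zero_of_mul hne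
      have hji' := hlt j hj hji
      have := (hB j).2 (p i) (right_ne_zero_of_mul hne) fun h => hji (hp h).symm
      exact Term.lt_irrefl _ (this.trans hji')
    · simp
  · intro q hq hqi
    rw [mem_termSupport, hcoeff] at hq
    obtain ⟨j, -, hj⟩ := Finset.exists_ne_zero_of_sum_ne_zero hq
    have hcj := left_ne_zero_of_mul hj
    by_cases hqj : q = p j
    · subst hqj
      exact hlt j hcj fun h => hqi (h ▸ rfl)
    · have h1 := (hB j).2 q (right_ne_zero_of_mul hj) hqj
      by_cases hji : j = i
      · exact hji ▸ h1
      · exact h1.trans (hlt j hcj hji)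

end LeadingTerm

/-! ### Homogeneous components and homogeneous Gröbner bases -/

section Components

variable {K : Type*} [Field K] {n m s : ℕ} {δ : Fin n → Fin m → ℤ} {e : Fin s → Fin m → ℤ}

variable (δ e) in
/-- The homogeneous component of degree `d` of a vector. -/
noncomputable def homogComponent (d : Fin m → ℤ) (v : Fin s → PolyRing K n) :
    Fin s → PolyRing K n :=
  fun i => MvPolynomial.weightedHomogeneousComponent δ (d - e i) (v i)

open Classical in
theorem coeff_homogComponent (d : Fin m → ℤ) (v : Fin s → PolyRing K n) (p : Term n s) :
    (homogComponent δ e d v p.2).coeff p.1 =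
      if p.degree δ e = d then (v p.2).coeff p.1 else 0 := by
  rw [homogComponent, MvPolynomial.coeff_weightedHomogeneousComponent]
  simp only [Term.degree, eq_sub_iff_add_eq]
  congr

theorem isHomog_homogComponent (d : Fin m → ℤ) (v : Fin s → PolyRing K n) :
    IsHomog δ e (homogComponent δ e d v) d := by
  classical
  intro p hp
  rw [mem_termSupport, coeff_homogComponent] at hp
  by_contra h
  exact hp (if_neg h)

/-- This allows Gröbner basis elements to be replaced by homogeneous ones without changing their
leading terms. -/
theorem IsLT.homogComponent {σ : MonomialOrder (Fin n)} {κ : ModuleOrderKind}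
    {v : Fin s → PolyRing K n} {p : Term n s} (h : IsLT σ κ v p) :
    IsLT σ κ (homogComponent δ e (p.degree δ e) v) p := by
  classical
  refine ⟨?_, fun q hq hqp => h.2 q ?_ hqp⟩
  · rw [mem_termSupport, coeff_homogComponent, if_pos rfl]
    exact h.1
  · rw [mem_termSupport, coeff_homogComponent] at hq
    exact fun h' => hq (by simp [h'])

/-- If a graded linear map sends a vector to the component of degree `d`, then it does not see the
other components of the vector. -/
theorem map_homogComponent {M : Type*} [AddCommGroup M] [Module K M]
    {comp : (Fin m → ℤ) → Submodule K M} (hcomp : iSupIndep comp)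
    (ψ : (Fin s → PolyRing K n) →ₗ[K] M)
    (hψ : ∀ p : Term n s, ψ (p.vec K) ∈ comp (p.degree δ e))
    {d : Fin m → ℤ} {v : Fin s → PolyRing K n} (hv : ψ v ∈ comp d) :
    ψ (homogComponent δ e d v) ∈ comp d ∧ ψ (homogComponent δ e d v) = ψ v := by
  classical
  have h₁ : ψ (homogComponent δ e d v) ∈ comp d := by
    refine mem_of_forall_vec_mem ((comp d).comap ψ) fun p hp => ?_
    rw [← isHomog_homogComponent d v p hp]
    exact hψ p
  refine ⟨h₁, ?_⟩
  -- The image of the remaining part lies both in the sum of the other components and in `comp d`,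
  -- so independence makes it zero.
  have h₂ : ψ (v - homogComponent δ e d v) ∈ ⨆ d' ≠ d, comp d' := by
    refine mem_of_forall_vec_mem ((⨆ d' ≠ d, comp d').comap ψ) fun p hp => ?_
    have hne : p.degree δ e ≠ d := by
      intro h
      refine hp ?_
      rw [Pi.sub_apply, MvPolynomial.coeff_sub, coeff_homogComponent, if_pos h, sub_self]
    exact Submodule.mem_iSup_of_mem (p.degree δ e) (Submodule.mem_iSup_of_mem hne (hψ p))
  have h₃ : ψ (v - homogComponent δ e d v) ∈ comp d := by
    rw [map_sub]
    exact (comp d).sub_mem hv h₁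
  have h₄ := Submodule.disjoint_def.1 (hcomp d) _ h₃ h₂
  rw [map_sub, sub_eq_zero] at h₄
  exact h₄.symm

/-- A submodule that contains the homogeneous components of its elements has a homogeneous Gröbner
basis. -/
theorem exists_isGroebnerBasis (σ : MonomialOrder (Fin n)) (κ : ModuleOrderKind)
    (S : Submodule (PolyRing K n) (Fin s → PolyRing K n))
    (hS : ∀ d, ∀ v ∈ S, homogComponent δ e d v ∈ S) :
    ∃ 𝒢, IsGroebnerBasis σ κ S 𝒢 ∧ ∀ g ∈ 𝒢, ∃ d, IsHomog δ e g d := by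
  -- Finitely many leading terms divide all leading terms of `S`; each is realized by a homogeneous
  -- component of an element of `S`.
  obtain ⟨Q, hQ, hfin, hdiv⟩ := Term.exists_finite_divides {p | ∃ v ∈ S, IsLT σ κ v p}
  have hQ' : ∀ p ∈ Q, ∃ v, v ∈ S ∧ IsLT σ κ v p := fun p hp => hQ hp
  choose! v hvS hv using hQ'
  let g : Term n s → Fin s → PolyRing K n := fun p => homogComponent δ e (p.degree δ e) (v p)
  have hg : ∀ p ∈ Q, IsLT σ κ (g p) p := fun p hp => (hv p hp).homogComponent
  refine ⟨g '' Q, ⟨hfin.image g, ?_, ?_⟩, ?_⟩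
  · rintro _ ⟨p, hp, rfl⟩
    exact ⟨hS _ _ (hvS p hp), (hg p hp).ne_zero⟩
  · intro w hw p hp
    obtain ⟨q, hq, hqp⟩ := hdiv p ⟨w, hw, hp⟩
    exact ⟨g q, ⟨q, hq, rfl⟩, q, hg q hq, hqp⟩
  · rintro _ ⟨p, hp, rfl⟩
    exact ⟨_, isHomog_homogComponent _ _⟩

end Components

/-! ### Weights of monomials -/

section Weights

variable {K : Type*} [Field K] {n m k : ℕ} {T : Type*} [Group T]
  {θ : T ≃* (Fin k → Kˣ)} {δ : Fin n → Fin m → ℤ} {act : PolyAction K T δ}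

theorem character_add (θ : T ≃* (Fin k → Kˣ)) (w w' : Fin k → ℤ) (τ : T) :
    character θ (w + w') τ = character θ w τ * character θ w' τ := by
  simp [character, zpow_add, Finset.prod_mul_distrib]

/-- The image of 1 is idempotent by multiplicativity and nonzero by invertibility of the action, and
the polynomial ring is a domain. -/
theorem PolyAction.map_one (act : PolyAction K T δ) (τ : T) : act.ρ τ 1 = 1 := by
  have h := act.map_mul τ 0 0 1 1 (MvPolynomial.isWeightedHomogeneous_one K δ)
    (MvPolynomial.isWeightedHomogeneous_one K δ)
  rw [mul_one] at h
  refine mul_left_cancel₀ ?_ (h.symm.trans (mul_one _).symm)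
  intro h0
  have h1 := act.ρ.inv_self_apply τ 1
  rw [h0, map_zero] at h1
  exact zero_ne_one h1

/-- If the variables are weight vectors, then so are the monomials. -/
theorem PolyAction.exists_hasWeight_monomial
    (hX : ∀ j, ∃ w, HasWeight θ act.ρ (MvPolynomial.X j) w) (a : Fin n →₀ ℕ) :
    ∃ w, HasWeight θ act.ρ (MvPolynomial.monomial a 1) w := by
  have hmul : ∀ a b : Fin n →₀ ℕ, (∃ w, HasWeight θ act.ρ (MvPolynomial.monomial a 1) w) →
      (∃ w, HasWeight θ act.ρ (MvPolynomial.monomial b 1) w) →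
      ∃ w, HasWeight θ act.ρ (MvPolynomial.monomial (a + b) 1) w := by
    rintro a b ⟨w, hw⟩ ⟨w', hw'⟩
    refine ⟨w + w', ?_, fun τ => ?_⟩
    · simp
    · have h := act.map_mul τ _ _ _ _
        (MvPolynomial.isWeightedHomogeneous_monomial δ a (1 : K) rfl)
        (MvPolynomial.isWeightedHomogeneous_monomial δ b (1 : K) rfl)
      rw [MvPolynomial.monomial_mul, one_mul] at h
      rw [h, hw.2, hw'.2, character_add, smul_mul_smul_comm, MvPolynomial.monomial_mul, one_mul,
        Units.val_mul]
  have hzero : ∃ w, HasWeight θ act.ρ (MvPolynomial.monomial 0 1) w := by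
    refine ⟨0, ?_, fun τ => ?_⟩
    · simp
    · have h1 : (MvPolynomial.monomial 0 1 : PolyRing K n) = 1 := rfl
      rw [h1, act.map_one]
      simp [character]
  induction a using Finsupp.induction_linear with
  | zero => exact hzero
  | add a b ha hb => exact hmul a b ha hb
  | single j c =>
    induction c with
    | zero => simpa using hzero
    | succ c ih =>
      rw [Finsupp.single_add]
      exact hmul _ _ ih (hX j)

end Weights

/-! ### Runs of the algorithm: existence and shape of the output -/

section Algorithm

variable {K : Type*} [Field K] {n m k s : ℕ} {T : Type*} [Group T]
  {θ : T ≃* (Fin k → Kˣ)} {δ : Fin n → Fin m → ℤ} {act : PolyAction K T δ}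
  {e : Fin s → Fin m → ℤ} {σ : MonomialOrder (Fin n)} {κ : ModuleOrderKind}

variable (θ act) in
/-- `v` is the weight recorded for the term `p`. -/
def IsTermWeight (W : Fin s → Fin k → ℤ) (p : Term n s) (v : Fin k → ℤ) : Prop :=
  ∃ w, HasWeight θ act.ρ (MvPolynomial.monomial p.1 1) w ∧ v = w + W p.2

/-- On a matrix whose columns are distinct terms, weight propagation returns the weights of these
terms in some order. -/
theorem PropagateSingleDegree.exists_terms {r : ℕ} {L : Fin r → Term n s}
    {W : Fin s → Fin k → ℤ} {C : Matrix (Fin r) (Fin r) K} {V : Fin r → Fin k → ℤ}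
    (h : PropagateSingleDegree θ act e σ κ (Matrix.of fun a b => (L b).vec K a) W C V) :
    ∃ L' : Fin r → Term n s, Function.Injective L' ∧ Set.range L' ⊆ Set.range L ∧
      ∀ i, IsTermWeight θ act W (L' i) (V i) := by
  obtain ⟨_, _, 𝒢, G, -, -, -, hsort, -, hG, hV⟩ := h
  choose L' hlt hw using hV
  refine ⟨L', ?_, ?_, hw⟩
  · have hne : ∀ i j, i < j → L' i ≠ L' j := by
      intro i j hij heq
      obtain ⟨hup, hdown⟩ := hsort i j hij _ _ (hlt i) (hlt j)
      rw [heq] at hup hdown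
      by_cases hκ : κ.IsUp
      · exact Term.lt_irrefl _ (hup hκ)
      · exact Term.lt_irrefl _ (hdown hκ)
    intro i j heq
    rcases lt_trichotomy i j with h | h | h
    · exact (hne i j h heq).elim
    · exact h
    · exact (hne j i h heq.symm).elim
  · rintro _ ⟨i, rfl⟩
    classical
    -- As the change of basis has constant entries, only the terms `L j` themselves can occur in a
    -- column of `G`.
    have hcol : ∀ a, G a i = ∑ j, (L j).vec K a * MvPolynomial.C (C j i) := fun a => by
      rw [hG]
      rfl
    have h0 := (hlt i).1
    rw [mem_termSupport, Matrix.col_apply, hcol, MvPolynomial.coeff_sum] at h0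
    obtain ⟨j, -, hj⟩ := Finset.exists_ne_zero_of_sum_ne_zero h0
    rw [mul_comm, MvPolynomial.coeff_C_mul] at hj
    exact ⟨j, Term.mem_termSupport_vec.1 (right_ne_zero_of_mul hj)⟩

/-- Distinct terms of the same degree are the reduced Gröbner basis of the module that they
generate. -/
theorem isReducedGroebnerBasis_range_vec (hδ : IsPositiveGrading δ) (σ : MonomialOrder (Fin n))
    (κ : ModuleOrderKind) {r : ℕ} {L : Fin r → Term n s} {d : Fin m → ℤ}
    (hd : ∀ b, (L b).degree δ e = d) :
    IsReducedGroebnerBasis σ κ (columnSpan (Matrix.of fun a b => (L b).vec K a))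
      (Set.range fun b => (L b).vec K) where
  finite := Set.finite_range _
  subset := by
    rintro _ ⟨b, rfl⟩
    exact ⟨Submodule.subset_span ⟨b, rfl⟩, Term.vec_ne_zero _⟩
  divides := by
    intro v hv p hp
    obtain ⟨c, rfl⟩ := (Submodule.mem_span_range_iff_exists_fun _).1 hv
    have h0 := hp.1
    rw [mem_termSupport, Finset.sum_apply, MvPolynomial.coeff_sum] at h0
    obtain ⟨b, -, hb⟩ := Finset.exists_ne_zero_of_sum_ne_zero h0
    refine ⟨_, ⟨b, rfl⟩, L b, Term.isLT_vec _, ?_⟩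
    have hb' : (c b * (L b).vec K p.2).coeff p.1 ≠ 0 := hb
    by_cases h2 : p.2 = (L b).2
    · rw [Term.vec, h2, Pi.single_eq_same, MvPolynomial.coeff_mul_monomial'] at hb'
      refine ⟨?_, h2.symm⟩
      by_contra hle
      exact hb' (if_neg hle)
    · rw [Term.vec, Pi.single_eq_of_ne h2, mul_zero] at hb'
      exact (hb' (MvPolynomial.coeff_zero _)).elim
  monic := by
    classical
    rintro _ ⟨b, rfl⟩ p hp
    rw [Term.coeff_vec, if_pos (Term.mem_termSupport_vec.1 hp.1)]
  reduced := by
    rintro _ ⟨b, rfl⟩ p hp _ ⟨b', rfl⟩ hne q hq hqp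
    have h1 := Term.mem_termSupport_vec.1 hp
    have h2 := Term.mem_termSupport_vec.1 hq.1
    subst h1 h2
    exact hne (congrArg _ (hqp.eq_of_degree_eq hδ ((hd b').trans (hd b).symm)))

theorem exists_perm_sorted (σ : MonomialOrder (Fin n)) (κ : ModuleOrderKind) {r : ℕ}
    {L : Fin r → Term n s} (hL : Function.Injective L) :
    ∃ π : Equiv.Perm (Fin r), ∀ i j, i < j →
      (κ.IsUp → Term.Lt σ κ (L (π i)) (L (π j))) ∧
      (¬ κ.IsUp → Term.Lt σ κ (L (π j)) (L (π i))) := by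
  obtain ⟨α, _, _, key, hinj, h⟩ := Term.exists_key σ κ s
  have hinj' : Function.Injective (key ∘ L) := hinj.comp hL
  by_cases hκ : κ.IsUp
  · refine ⟨Tuple.sort (key ∘ L), fun i j hij => ⟨fun _ => (h _ _).2 ?_, fun h' => (h' hκ).elim⟩⟩
    exact (Tuple.monotone_sort (key ∘ L)).strictMono_of_injective
      (hinj'.comp (Equiv.injective _)) hij
  · refine ⟨Tuple.sort (OrderDual.toDual ∘ key ∘ L), fun i j hij =>
      ⟨fun h' => (hκ h').elim, fun _ => (h _ _).2 ?_⟩⟩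
    exact (Tuple.monotone_sort (OrderDual.toDual ∘ key ∘ L)).strictMono_of_injective
      ((OrderDual.toDual.injective.comp hinj').comp (Equiv.injective _)) hij

/-- The columns are their own reduced Gröbner basis and truncation removes nothing, so only sorting
remains and the change of basis is a permutation matrix. -/
theorem exists_propagateSingleDegree (hδ : IsPositiveGrading δ)
    (hX : ∀ j, ∃ w, HasWeight θ act.ρ (MvPolynomial.X j) w) {r : ℕ} (hr : 0 < r)
    {L : Fin r → Term n s} (hL : Function.Injective L) {d : Fin m → ℤ}
    (hd : ∀ b, (L b).degree δ e = d) (W : Fin s → Fin k → ℤ) :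
    ∃ C V, PropagateSingleDegree θ act e σ κ (Matrix.of fun a b => (L b).vec K a) W C V := by
  classical
  obtain ⟨π, hπ⟩ := exists_perm_sorted σ κ hL
  choose w hw using fun p : Term n s => PolyAction.exists_hasWeight_monomial hX p.1
  have hhomog : ∀ b, IsHomog δ e ((L b).vec K) d := fun b => hd b ▸ Term.isHomog_vec _
  refine ⟨(1 : Matrix (Fin r) (Fin r) K).submatrix (Equiv.refl _) π,
    fun i => w (L (π i)) + W (L (π i)).2, hr, d, Set.range fun b => (L b).vec K,
    Matrix.of fun a b => (L (π b)).vec K a, ⟨?_, ?_⟩,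
    isReducedGroebnerBasis_range_vec hδ σ κ hd, ?_, ?_, ?_, ?_, ?_⟩
  · exact Term.vec_ne_zero _
  · exact hhomog _
  · have htr : truncation δ e (Set.range fun b => (L b).vec K) d =
        Set.range fun b => (L b).vec K := by
      refine Set.Subset.antisymm (fun g hg => hg.1) ?_
      rintro _ ⟨b, rfl⟩
      exact ⟨⟨b, rfl⟩, d, hhomog b, le_rfl⟩
    rw [htr]
    exact π.surjective.range_comp fun b => (L b).vec K
  · intro i j hij p q hp hq
    have hp' : IsLT σ κ ((L (π i)).vec K) p := hp
    have hq' : IsLT σ κ ((L (π j)).vec K) q := hq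
    rw [hp'.unique (Term.isLT_vec _), hq'.unique (Term.isLT_vec _)]
    exact hπ i j hij
  · rw [Matrix.isUnit_submatrix_equiv]
    exact isUnit_one
  · ext1 a b
    change (L (π b)).vec K a = ∑ j, (L j).vec K a *
      MvPolynomial.C ((1 : Matrix (Fin r) (Fin r) K) j (π b))
    simp [Matrix.one_apply, apply_ite MvPolynomial.C]
  · exact fun i => ⟨L (π i), Term.isLT_vec _, w (L (π i)), hw _, rfl⟩

/-- All columns share the degree `d`, so a single block suffices. Blocks must be non-empty, hence an
empty matrix is cut into zero blocks. -/
theorem exists_propagate (hδ : IsPositiveGrading δ)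
    (hX : ∀ j, ∃ w, HasWeight θ act.ρ (MvPolynomial.X j) w) {r : ℕ}
    {L : Fin r → Term n s} (hL : Function.Injective L) {d : Fin m → ℤ}
    (hd : ∀ b, (L b).degree δ e = d) (W : Fin s → Fin k → ℤ) :
    ∃ C V, Propagate θ act e σ κ (Matrix.of fun a b => (L b).vec K a) W C V := by
  obtain rfl | hr := r.eq_zero_or_pos
  · exact ⟨_, _, 1, 0, fun i => i.elim0, rfl, fun i => i.elim0, fun i => i.elim0,
      fun i => i.elim0, fun i => i.elim0, fun i => i.elim0, fun i => i.elim0,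
      fun i => i.elim0, rfl, rfl⟩
  · have hc : ∑ _i : Fin 1, r = r := by simp
    let ι : (Σ _i : Fin 1, Fin r) ≃ Fin r := finSigmaFinEquiv.trans (finCongr hc)
    have h : ∀ i : Fin 1, ∃ C V, PropagateSingleDegree θ act e σ κ
        (Matrix.of fun a b => (L (ι ⟨i, b⟩)).vec K a) W C V := fun i =>
      exists_propagateSingleDegree hδ hX hr
        (hL.comp (ι.injective.comp sigma_mk_injective)) (fun b => hd _) W
    choose Cs Vs hCV using h
    exact ⟨_, _, 1, 1, fun _ => r, hc, fun _ => d, Cs, Vs, fun _ => hr,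
      fun i b => ⟨Term.vec_ne_zero _, hd (ι ⟨i, b⟩) ▸ Term.isHomog_vec _⟩,
      Function.injective_of_subsingleton _, hCV, rfl, rfl⟩

/-- The bijections `ι` and `P` distribute the terms over the blocks, and each block lists its own
terms in some order. The conclusion is a relation between terms and recorded vectors, since over a
finite field a weight need not be determined by its weight vector. -/
theorem Propagate.exists_terms {r : ℕ} {L : Fin r → Term n s} (hL : Function.Injective L)
    {W : Fin s → Fin k → ℤ} {C : Matrix (Fin r) (Fin r) K} {V : List (Fin k → ℤ)}
    (h : Propagate θ act e σ κ (Matrix.of fun a b => (L b).vec K a) W C V) :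
    ∃ L' : List (Term n s), L'.Nodup ∧ (∀ p, p ∈ L' ↔ p ∈ Set.range L) ∧
      List.Forall₂ (IsTermWeight θ act W) L' V := by
  obtain ⟨P, l, c, hc, D, Cs, Vs, -, -, -, hprop, -, rfl⟩ := h
  let ι : (Σ i : Fin l, Fin (c i)) ≃ Fin r := finSigmaFinEquiv.trans (finCongr hc)
  let Lb (i : Fin l) (b : Fin (c i)) : Term n s := L (P (ι ⟨i, b⟩))
  have hLb : ∀ i, Function.Injective (Lb i) := fun i =>
    hL.comp (P.injective.comp (ι.injective.comp sigma_mk_injective))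
  have h : ∀ i, ∃ L' : Fin (c i) → Term n s, Function.Injective L' ∧
      Set.range L' ⊆ Set.range (Lb i) ∧ ∀ b, IsTermWeight θ act W (L' b) (Vs i b) := fun i =>
    (hprop i).exists_terms (L := Lb i)
  choose L' hinj hsub hw using h
  -- Both sets have `c i` elements, so the inclusion is an equality.
  have hrange : ∀ i, Set.range (L' i) = Set.range (Lb i) := by
    intro i
    refine Set.eq_of_subset_of_ncard_le (hsub i) ?_ (Set.finite_range _)
    rw [← Set.image_univ, ← Set.image_univ, Set.ncard_image_of_injective _ (hinj i),
      Set.ncard_image_of_injective _ (hLb i)]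
  refine ⟨(List.ofFn fun i => List.ofFn (L' i)).flatten, ?_, ?_, ?_⟩
  · rw [List.nodup_flatten]
    constructor
    · intro l hl
      obtain ⟨i, rfl⟩ := List.mem_ofFn.1 hl
      exact List.nodup_ofFn.2 (hinj i)
    · rw [List.pairwise_ofFn]
      intro i j hij p hpi hpj
      have hi : p ∈ Set.range (Lb i) := hrange i ▸ List.mem_ofFn.1 hpi
      have hj : p ∈ Set.range (Lb j) := hrange j ▸ List.mem_ofFn.1 hpj
      obtain ⟨b, hb⟩ := hi
      obtain ⟨b', hb'⟩ := hj
      have := ι.injective (P.injective (hL (hb.trans hb'.symm)))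
      exact hij.ne (congrArg Sigma.fst this)
  · intro p
    have : p ∈ (List.ofFn fun i => List.ofFn (L' i)).flatten ↔ ∃ i, p ∈ Set.range (Lb i) := by
      simp [← hrange, List.mem_ofFn]
    rw [this]
    constructor
    · rintro ⟨i, b, rfl⟩
      exact ⟨_, rfl⟩
    · rintro ⟨a, rfl⟩
      refine ⟨(ι.symm (P.symm a)).1, (ι.symm (P.symm a)).2, ?_⟩
      simp [Lb]
  · refine List.rel_flatten ?_
    rw [List.forall₂_iff_get]
    refine ⟨by simp, fun i h₁ h₂ => ?_⟩
    rw [List.forall₂_iff_get]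
    simp only [List.get_ofFn]
    refine ⟨by simp, fun b h₁ h₂ => ?_⟩
    simpa using hw _ _

theorem exists_propagateGradedComponents (hδ : IsPositiveGrading δ)
    (hX : ∀ j, ∃ w, HasWeight θ act.ρ (MvPolynomial.X j) w) {q : ℕ}
    (N : Matrix (Fin s) (Fin q) (PolyRing K n))
    (hN : ∀ d, ∀ v ∈ columnSpan N, homogComponent δ e d v ∈ columnSpan N)
    (W : Fin s → Fin k → ℤ) (d : Fin m → ℤ) :
    ∃ V, PropagateGradedComponents θ act e σ κ d N W V := by
  obtain ⟨𝒢, h𝒢⟩ := exists_isGroebnerBasis (e := e) σ κ (columnSpan N) hN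
  have hfin : {p : Term n s | p.degree δ e = d ∧
      ∀ g ∈ 𝒢, ∀ q, IsLT σ κ g q → ¬ q.Divides p}.Finite :=
    (Term.finite_degree_eq hδ e d).subset fun p hp => hp.1
  let L := hfin.toFinset.toList
  have hL : L.Nodup := Finset.nodup_toList _
  have hmem : ∀ p, p ∈ L ↔ p.degree δ e = d ∧
      ∀ g ∈ 𝒢, ∀ q, IsLT σ κ g q → ¬ q.Divides p := by
    simp [L]
  obtain ⟨C, V, hCV⟩ := exists_propagate (e := e) (σ := σ) (κ := κ) hδ hX
    (List.nodup_iff_injective_get.1 hL) (fun b => ((hmem _).1 (L.get_mem b)).1) W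
  exact ⟨V, 𝒢, L, h𝒢, ⟨hL, hmem⟩, C, hCV⟩

end Algorithm

/-! ### Leading terms of a triangularly related basis -/

section Triangular

variable {K : Type*} [Field K] {n s : ℕ}

/-- The columns of the inverse of a matrix that is triangular in the direction of the module term
ordering have their leading terms on the diagonal. -/
theorem isLT_col_of_triangular {σ : MonomialOrder (Fin n)} {κ : ModuleOrderKind}
    {U U' : Matrix (Fin s) (Fin s) (PolyRing K n)} (h : U * U' = 1)
    (hup : κ.IsUp → ∀ i j, j < i → U i j = 0) (hdown : ¬ κ.IsUp → ∀ i j, i < j → U i j = 0)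
    (hconst : κ.IsTermOverPosition → ∀ i j, ∃ c : K, U i j = MvPolynomial.C c) (j : Fin s) :
    IsLT σ κ (U'.col j) (0, j) := by
  have hinv : U⁻¹ = U' := Matrix.inv_eq_right_inv h
  have := invertibleOfRightInverse U U' h
  have hup' : κ.IsUp → ∀ i j, j < i → U' i j = 0 := by
    intro hκ
    have hU : U.BlockTriangular id := fun i j hij => hup hκ i j hij
    have hU' := Matrix.blockTriangular_inv_of_blockTriangular hU
    rw [hinv] at hU'
    exact fun i j hij => hU' hij
  have hdown' : ¬ κ.IsUp → ∀ i j, i < j → U' i j = 0 := by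
    intro hκ
    have hU : U.BlockTriangular OrderDual.toDual := fun i j hij => hdown hκ i j hij
    have hU' := Matrix.blockTriangular_inv_of_blockTriangular hU
    rw [hinv] at hU'
    exact fun i j hij => hU' hij
  have hconst' : κ.IsTermOverPosition → ∀ i j, ∃ c : K, U' i j = MvPolynomial.C c := by
    intro hκ
    choose U₀ hU₀ using hconst hκ
    -- This ring endomorphism fixes the entries of `U`, so it sends `U'` to another right inverse of
    -- `U`, which must be `U'` again. Hence `U'` has constant entries.
    let ev : PolyRing K n →+* PolyRing K n := MvPolynomial.C.comp MvPolynomial.constantCoeff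
    have hU : ev.mapMatrix U = U := by
      ext1 i j
      simp [ev, hU₀]
    have h2 : U * ev.mapMatrix U' = 1 := by
      have := congrArg ev.mapMatrix h
      rwa [map_mul, map_one, hU] at this
    have h3 : ev.mapMatrix U' = U' := (Matrix.inv_eq_right_inv h2).symm.trans hinv
    intro i j
    exact ⟨MvPolynomial.constantCoeff (U' i j), (congrFun (congrFun h3 i) j).symm⟩
  -- By triangularity only the diagonal product survives, so `U' j j` is a unit of the polynomial
  -- ring, that is, a nonzero constant.
  have hdiag : U j j * U' j j = 1 := by
    have hjj : (U * U') j j = 1 := by rw [h, Matrix.one_apply_eq]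
    rw [Matrix.mul_apply, Finset.sum_eq_single j] at hjj
    · exact hjj
    · intro l _ hlj
      by_cases hκ : κ.IsUp
      · rcases lt_or_gt_of_ne hlj with hl | hl
        · rw [hup hκ _ _ hl, zero_mul]
        · rw [hup' hκ _ _ hl, mul_zero]
      · rcases lt_or_gt_of_ne hlj with hl | hl
        · rw [hdown' hκ _ _ hl, mul_zero]
        · rw [hdown hκ _ _ hl, zero_mul]
    · simp
  obtain ⟨c, hc, hcj⟩ := MvPolynomial.isUnit_iff_eq_C_of_isReduced.1
    (IsUnit.of_mul_eq_one_right _ hdiag)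
  refine ⟨?_, fun p hp hne => ?_⟩
  · rw [mem_termSupport]
    simpa [hcj] using hc.ne_zero
  · classical
    have hp' : (U' p.2 j).coeff p.1 ≠ 0 := hp
    have hpj : p.2 ≠ j := by
      intro hpj
      rw [hpj, hcj, MvPolynomial.coeff_C] at hp'
      refine hne (Prod.ext ?_ hpj)
      by_contra h0
      exact hp' (if_neg fun h => h0 h.symm)
    have hU0 : U' p.2 j ≠ 0 := fun h0 => hp' (by simp [h0])
    have htop : κ.IsTermOverPosition → p.1 = 0 := by
      intro hκ
      obtain ⟨c, hc⟩ := hconst' hκ p.2 j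
      rw [hc, MvPolynomial.coeff_C] at hp'
      by_contra h0
      exact hp' (if_neg fun h => h0 h.symm)
    have hlt : κ.IsUp → p.2 < j := fun hκ =>
      (lt_or_gt_of_ne hpj).resolve_right fun h' => hU0 (hup' hκ _ _ h')
    have hgt : ¬ κ.IsUp → j < p.2 := fun hκ =>
      (lt_or_gt_of_ne hpj).resolve_left fun h' => hU0 (hdown' hκ _ _ h')
    -- Position over term compares positions first, whatever the entries are. Term over position
    -- needs constant entries, which reduce the comparison to positions.
    cases κ
    · exact Or.inr ⟨htop trivial, hlt trivial⟩
    · exact Or.inl (hlt trivial)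
    · exact Or.inr ⟨htop trivial, hgt id⟩
    · exact Or.inl (hgt id)

end Triangular

/-! ### Macaulay's basis theorem -/

section StandardBasis

variable {K : Type*} [Field K] {n m s : ℕ} {δ : Fin n → Fin m → ℤ} {e : Fin s → Fin m → ℤ}
  {σ : MonomialOrder (Fin n)} {κ : ModuleOrderKind}
  {M : Type*} [AddCommGroup M] [Module K M] [Module (PolyRing K n) M]
  [IsScalarTower K (PolyRing K n) M]

/-- Macaulay's basis theorem for graded components: the images of homogeneous vectors whose leading
terms are the terms of degree `d` outside the leading term module of the kernel form a basis of the
component of degree `d`. -/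
theorem exists_basis_of_standard_terms
    {comp : (Fin m → ℤ) → Submodule K M} (hcomp : iSupIndep comp)
    (ψ : (Fin s → PolyRing K n) →ₗ[PolyRing K n] M) (hsurj : Function.Surjective ψ)
    (hψ : ∀ p : Term n s, ψ (p.vec K) ∈ comp (p.degree δ e))
    {𝒢 : Set (Fin s → PolyRing K n)} (h𝒢 : IsGroebnerBasis σ κ (LinearMap.ker ψ) 𝒢)
    (hhom : ∀ g ∈ 𝒢, ∃ d, IsHomog δ e g d)
    {B : Term n s → Fin s → PolyRing K n} (hB : ∀ p, IsLT σ κ (B p) p)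
    (hBhom : ∀ p, IsHomog δ e (B p) (p.degree δ e)) {d : Fin m → ℤ}
    {ι : Type*} [Finite ι] {L : ι → Term n s} (hL : Function.Injective L)
    (hmem : ∀ p, p ∈ Set.range L ↔ p.degree δ e = d ∧
      ∀ g ∈ 𝒢, ∀ q, IsLT σ κ g q → ¬ q.Divides p) :
    ∃ b : Module.Basis ι K (comp d), ∀ i, (b i : M) = ψ (B (L i)) := by
  classical
  have := Fintype.ofFinite ι
  let ψK : (Fin s → PolyRing K n) →ₗ[K] M := ψ.restrictScalars K
  have hmap : ∀ (d') (v : Fin s → PolyRing K n), IsHomog δ e v d' → ψK v ∈ comp d' :=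
    fun d' v hv => mem_of_forall_vec_mem ((comp d').comap ψK) fun p hp => hv p hp ▸ hψ p
  have hLd : ∀ i, (L i).degree δ e = d := fun i => ((hmem _).1 ⟨i, rfl⟩).1
  let b (i : ι) : comp d := ⟨ψK (B (L i)), hmap d _ (hLd i ▸ hBhom (L i))⟩
  -- A nontrivial relation would give an element of the kernel whose leading term is some `L i`, yet
  -- no leading term of `𝒢` divides `L i`.
  have hindep : LinearIndependent K b := by
    rw [Fintype.linearIndependent_iff]
    intro c hc
    by_contra hne
    push Not at hne
    obtain ⟨j, hj⟩ := hne
    obtain ⟨i, hi⟩ := exists_isLT_sum (B := fun i => B (L i)) hL (fun i => hB (L i))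
      (c := c) (Function.ne_iff.2 ⟨j, hj⟩)
    have hker : ∑ i, c i • B (L i) ∈ LinearMap.ker ψ := by
      rw [LinearMap.mem_ker]
      change ψK _ = 0
      rw [map_sum]
      simpa [b] using congrArg Subtype.val hc
    obtain ⟨g, hg, q, hq, hqp⟩ := h𝒢.divides _ hker _ hi
    exact ((hmem _).1 ⟨i, rfl⟩).2 g hg q hq hqp
  have hspan : ⊤ ≤ Submodule.span K (Set.range b) := by
    rintro ⟨x, hx⟩ -
    obtain ⟨v, rfl⟩ := hsurj x
    obtain ⟨-, hv⟩ := map_homogComponent hcomp ψK hψ (v := v) hx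
    -- The preimage of the span contains an element with each prescribed leading term `p` of degree
    -- `d`: `B p` if `p` is standard, otherwise a monomial multiple of an element of `𝒢`, which maps
    -- to 0.
    have hS : homogComponent δ e d v ∈
        ((Submodule.span K (Set.range b)).map (comp d).subtype).comap ψK := by
      refine mem_of_forall_exists_isLT (e := e) (d := d) σ κ _ (fun p hp => ?_)
        (isHomog_homogComponent d v)
      by_cases hstd : ∀ g ∈ 𝒢, ∀ q, IsLT σ κ g q → ¬ q.Divides p
      · obtain ⟨i, rfl⟩ := (hmem p).2 ⟨hp, hstd⟩
        exact ⟨B (L i), ⟨b i, Submodule.subset_span ⟨i, rfl⟩, rfl⟩, hp ▸ hBhom (L i), hB _⟩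
      · push Not at hstd
        obtain ⟨g, hg, q, hq, hqp⟩ := hstd
        obtain ⟨d', hd'⟩ := hhom g hg
        have hpq : (p.1 - q.1 + q.1, q.2) = p := Prod.ext (tsub_add_cancel_of_le hqp.1) hqp.2
        refine ⟨(MvPolynomial.monomial (p.1 - q.1) 1 : PolyRing K n) • g, ?_, ?_, ?_⟩
        · have h0 : ψK ((MvPolynomial.monomial (p.1 - q.1) 1 : PolyRing K n) • g) = 0 :=
            (LinearMap.ker ψ).smul_mem _ (h𝒢.subset g hg).1
          rw [Submodule.mem_comap, h0]
          exact Submodule.zero_mem _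
        · convert hd'.monomial_smul (p.1 - q.1) using 1
          rw [← hd' q hq.1, ← hp]
          conv_lhs => rw [← hpq]
          simp [Term.degree, add_assoc]
        · have := hq.monomial_smul (p.1 - q.1)
          rwa [hpq] at this
    obtain ⟨y, hy, hyx⟩ := hS
    have : y = ⟨ψ v, hx⟩ := Subtype.ext (hyx.trans hv)
    exact this ▸ hy
  refine ⟨Module.Basis.mk hindep hspan, fun i => ?_⟩
  rw [Module.Basis.mk_apply]
  rfl

end StandardBasis

/-! ### Coordinates and weights in the presentation -/

section Presentation

variable {K : Type*} [Field K] {n m k s q : ℕ} {T : Type*} [Group T]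
  {θ : T ≃* (Fin k → Kˣ)} {δ : Fin n → Fin m → ℤ} {act : PolyAction K T δ}
  {M : Type*} [AddCommGroup M] [Module K M] [Module (PolyRing K n) M]
  [IsScalarTower K (PolyRing K n) M]
  {F₀ : Type*} [AddCommGroup F₀] [Module K F₀] [Module (PolyRing K n) F₀]
  [IsScalarTower K (PolyRing K n) F₀]
  {e : Fin s → Fin m → ℤ}

theorem columnSpan_toMatrix {F₀ F₁ : Type*} [AddCommGroup F₀] [Module (PolyRing K n) F₀]
    [AddCommGroup F₁] [Module (PolyRing K n) F₁]
    (f₀ : Module.Basis (Fin s) (PolyRing K n) F₀)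
    (f₁ : Module.Basis (Fin q) (PolyRing K n) F₁) (d₁ : F₁ →ₗ[PolyRing K n] F₀) :
    columnSpan (LinearMap.toMatrix f₁ f₀ d₁) =
      (LinearMap.range d₁).map (f₀.equivFun : F₀ →ₗ[PolyRing K n] Fin s → PolyRing K n) := by
  rw [LinearMap.range_eq_map, ← f₁.span_eq, Submodule.map_span, Submodule.map_span, columnSpan,
    ← Set.range_comp, ← Set.range_comp]
  congr 2
  funext j i
  simp [LinearMap.toMatrix_apply]

theorem EquivModule.equivFun_symm_vec_mem (X₀ : EquivModule act F₀)
    {f₀ : Module.Basis (Fin s) (PolyRing K n) F₀} (hf₀ : ∀ i, f₀ i ∈ X₀.comp (e i))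
    (p : Term n s) : f₀.equivFun.symm (p.vec K) ∈ X₀.comp (p.degree δ e) := by
  classical
  have h : f₀.equivFun.symm (p.vec K) = (MvPolynomial.monomial p.1 1 : PolyRing K n) • f₀ p.2 := by
    rw [Module.Basis.equivFun_symm_apply, Finset.sum_eq_single p.2]
    · simp [Term.vec]
    · intro i _ hi
      rw [Term.vec, Pi.single_eq_of_ne hi, zero_smul]
    · simp
  rw [h]
  exact X₀.smul_mem _ _ _ _ (MvPolynomial.isWeightedHomogeneous_monomial δ p.1 1 rfl) (hf₀ p.2)

/-- The coordinates of a homogeneous element are homogeneous of the same degree. -/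
theorem EquivModule.isHomog_equivFun (X₀ : EquivModule act F₀)
    {f₀ : Module.Basis (Fin s) (PolyRing K n) F₀} (hf₀ : ∀ i, f₀ i ∈ X₀.comp (e i))
    {d : Fin m → ℤ} {x : F₀} (hx : x ∈ X₀.comp d) : IsHomog δ e (f₀.equivFun x) d := by
  -- Taking the inverse of the coordinate map as the graded map, injectivity shows that the
  -- coordinate vector equals its component of degree `d`.
  have h := (map_homogComponent X₀.isInternal.submodule_iSupIndep
    (f₀.equivFun.symm.toLinearMap.restrictScalars K) (X₀.equivFun_symm_vec_mem hf₀)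
    (v := f₀.equivFun x) (d := d) (by simpa using hx)).2
  have h' : homogComponent δ e d (f₀.equivFun x) = f₀.equivFun x :=
    f₀.equivFun.symm.injective h
  rw [← h']
  exact isHomog_homogComponent _ _

/-- The image in `M` of a monomial multiple of a weight vector of `F₀` is zero or a weight
vector. -/
theorem IsMorphism.hasWeight_monomial_smul {X : EquivModule act M} {X₀ : EquivModule act F₀}
    {π : F₀ →ₗ[PolyRing K n] M} (hπ : IsMorphism X₀ X π) {a : Fin n →₀ ℕ} {x : F₀}
    {d : Fin m → ℤ} (hx : x ∈ X₀.comp d) {w w' : Fin k → ℤ}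
    (ha : HasWeight θ act.ρ (MvPolynomial.monomial a 1) w) (hw' : HasWeight θ X₀.ρ x w')
    (h0 : π ((MvPolynomial.monomial a 1 : PolyRing K n) • x) ≠ 0) :
    HasWeight θ X.ρ (π ((MvPolynomial.monomial a 1 : PolyRing K n) • x)) (w + w') := by
  refine ⟨h0, fun τ => ?_⟩
  rw [← hπ.equivariant, X₀.map_smul τ _ _ _ _
    (MvPolynomial.isWeightedHomogeneous_monomial δ a (1 : K) rfl) hx, ha.2, hw'.2, character_add,
    smul_assoc, smul_algebra_smul_comm (character θ w' τ : K), smul_smul, Units.val_mul]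
  exact (π.restrictScalars K).map_smul _ _

end Presentation

end WeightPropagation

/-! ### The proposition -/

theorem proposition4p12
    {K : Type*} [Field K] {n m k : ℕ}
    -- a torus with coordinates, acting on the positively graded polynomial ring
    {T : Type*} [Group T] (θ : T ≃* (Fin k → Kˣ))
    (δ : Fin n → Fin m → ℤ) (hδ : IsPositiveGrading δ)
    (act : PolyAction K T δ) (hX : ∀ j, ∃ w, HasWeight θ act.ρ (MvPolynomial.X j) w)
    -- a presentation `F₁ → F₀ → M → 0`
    {M : Type*} [AddCommGroup M] [Module K M] [Module (PolyRing K n) M] [IsScalarTower K (PolyRing K n) M]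
    {F₀ : Type*} [AddCommGroup F₀] [Module K F₀] [Module (PolyRing K n) F₀]
    [IsScalarTower K (PolyRing K n) F₀]
    {F₁ : Type*} [AddCommGroup F₁] [Module K F₁] [Module (PolyRing K n) F₁]
    [IsScalarTower K (PolyRing K n) F₁]
    (X : EquivModule act M) (X₀ : EquivModule act F₀) (X₁ : EquivModule act F₁)
    (hfree₀ : IsFreeObject X₀) (hfree₁ : IsFreeObject X₁)
    (d₁ : F₁ →ₗ[PolyRing K n] F₀) (π : F₀ →ₗ[PolyRing K n] M)
    (hd₁ : IsMorphism X₁ X₀ d₁) (hπ : IsMorphism X₀ X π)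
    (hexact : Function.Exact d₁ π) (hsurj : Function.Surjective π)
    -- homogeneous bases of `F₀` and `F₁`
    {s q : ℕ} (f₀ : Module.Basis (Fin s) (PolyRing K n) F₀) (e : Fin s → Fin m → ℤ)
    (hf₀ : ∀ i, f₀ i ∈ X₀.comp (e i))
    (f₁ : Module.Basis (Fin q) (PolyRing K n) F₁) (hf₁ : ∀ j, ∃ d', f₁ j ∈ X₁.comp d')
    -- a module term ordering
    (σ : MonomialOrder (Fin n)) (κ : ModuleOrderKind)
    -- a homogeneous basis of weight vectors of `F₀`, triangularly related to `f₀`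
    (f' : Module.Basis (Fin s) (PolyRing K n) F₀) (hf' : ∀ i, ∃ d', f' i ∈ X₀.comp d')
    (W : Fin s → Fin k → ℤ) (hW : ∀ i, HasWeight θ X₀.ρ (f' i) (W i))
    (hup : κ.IsUp → ∀ i j, j < i → f'.toMatrix f₀ i j = 0)
    (hdown : ¬ κ.IsUp → ∀ i j, i < j → f'.toMatrix f₀ i j = 0)
    (hconst : κ.IsTermOverPosition → ∀ i j, ∃ c : K, f'.toMatrix f₀ i j = MvPolynomial.C c)
    (d : Fin m → ℤ) :
    (∃ V, PropagateGradedComponents θ act e σ κ d (LinearMap.toMatrix f₁ f₀ d₁) W V) ∧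
    ∀ V, PropagateGradedComponents θ act e σ κ d (LinearMap.toMatrix f₁ f₀ d₁) W V →
      ∃ b : Module.Basis (Fin V.length) K (X.comp d),
        ∀ i, HasWeight θ X.ρ (b i : M) (V.get i) := by
  let φ := f₀.equivFun
  let ψ : (Fin s → PolyRing K n) →ₗ[PolyRing K n] M := π ∘ₗ φ.symm.toLinearMap
  have hψ : ∀ p : Term n s, ψ (p.vec K) ∈ X.comp (p.degree δ e) := fun p =>
    hπ.map_mem _ _ (X₀.equivFun_symm_vec_mem hf₀ p)
  have hker : columnSpan (LinearMap.toMatrix f₁ f₀ d₁) = LinearMap.ker ψ := by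
    rw [columnSpan_toMatrix, ← hexact.linearMap_ker_eq]
    ext v
    simp [ψ, φ, Submodule.mem_map_equiv]
  have hindep := X.isInternal.submodule_iSupIndep
  constructor
  · refine exists_propagateGradedComponents hδ hX _ (fun d' v hv => ?_) W d
    rw [hker] at hv ⊢
    have h0 : ψ v = 0 := hv
    -- Since `ψ v = 0` lies in every component of `M`, every homogeneous component of `v` is again
    -- in the kernel.
    exact (map_homogComponent hindep (ψ.restrictScalars K) hψ (v := v) (d := d')
      (show ψ v ∈ X.comp d' by rw [h0]; exact Submodule.zero_mem _)).2.trans h0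
  · rintro V ⟨𝒢, L, ⟨h𝒢, hhom⟩, ⟨hL, hmem⟩, C, hprop⟩
    obtain ⟨L', hL', hmem', hV⟩ := hprop.exists_terms (List.nodup_iff_injective_get.1 hL)
    have hLT : ∀ j, IsLT σ κ (φ (f' j)) (0, j) := fun j =>
      isLT_col_of_triangular (Module.Basis.toMatrix_mul_toMatrix_flip f' f₀) hup hdown hconst j
    -- The term `f_j` occurs in the homogeneous element `f' j`, which forces its degree to be `e j`.
    have hdeg : ∀ j, f' j ∈ X₀.comp (e j) := by
      intro j
      obtain ⟨d', hd'⟩ := hf' j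
      have h := X₀.isHomog_equivFun hf₀ hd' _ (hLT j).1
      simp only [Term.degree, map_zero, zero_add] at h
      rwa [h]
    -- For the term t f_j this is t f̃_j in coordinates: the same leading term and degree, but a
    -- monomial multiple of a weight vector.
    let B (p : Term n s) : Fin s → PolyRing K n :=
      (MvPolynomial.monomial p.1 1 : PolyRing K n) • φ (f' p.2)
    obtain ⟨b, hb⟩ := exists_basis_of_standard_terms (σ := σ) (κ := κ) hindep ψ
      (hsurj.comp φ.symm.surjective) hψ (hker ▸ h𝒢) hhom (B := B) (d := d)
      (fun p => by simpa using (hLT p.2).monomial_smul p.1)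
      (fun p => (X₀.isHomog_equivFun hf₀ (hdeg p.2)).monomial_smul p.1)
      (List.nodup_iff_injective_get.1 hL')
      (fun p => by rw [← hmem, Set.range_list_get, Set.mem_ofPred_eq, hmem', Set.range_list_get]; rfl)
    refine ⟨b.reindex (finCongr hV.length_eq), fun i => ?_⟩
    obtain ⟨w, hw, hi⟩ := (List.forall₂_iff_get.1 hV).2 i (i.2.trans_eq hV.length_eq.symm) i.2
    have hbi : ((b.reindex (finCongr hV.length_eq) i : X.comp d) : M) =
        π ((MvPolynomial.monomial (L'.get ⟨i, i.2.trans_eq hV.length_eq.symm⟩).1 1 : PolyRing K n) •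
          f' (L'.get ⟨i, i.2.trans_eq hV.length_eq.symm⟩).2) := by
      rw [Module.Basis.reindex_apply, hb]
      simp [ψ, B]
    have hne : ((b.reindex (finCongr hV.length_eq) i : X.comp d) : M) ≠ 0 := fun h0 =>
      (b.reindex (finCongr hV.length_eq)).ne_zero i (Subtype.ext h0)
    rw [hbi] at hne ⊢
    have := hπ.hasWeight_monomial_smul (hdeg _) hw (hW _) hne
    rwa [← hi] at this
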